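/- Let $H = -\frac{d^2}{dx^2} + (x+i)^2$ be the shifted harmonic oscillator, regarded as an unbounded operator on $L^2(\mathbb{R})$ (complex-valued functions) with its maximal domain $$\mathrm{Dom}(H)=\{\psi\in L^2(\mathbb{R}) : -\psi''+(x+i)^2\psi\in L^2(\mathbb{R})\},$$ derivatives being taken in the sense of distributions; this is also the domain of the self-adjoint harmonic oscillator $-\frac{d^2}{dx^2}+x^2$. For $z\in\mathbb{C}$ let $\|(H-z)^{-1}\|$ denote the operator norm of the resolvent, with the convention $\|(H-z)^{-1}\|=\infty$ if $z$ belongs to the spectrum of $H$, i.e. if $H-z:\mathrm{Dom}(H)\to L^2(\mathbb{R})$ has no bounded everywhere defined inverse. Fix $\varepsilon>0$. Then there exists $C>0$ such that for all $z\in\mathbb{C}$ with $\operatorname{Re} z > C$ and $$|\operatorname{Im} z|\le 2(1-\varepsilon)\sqrt{\operatorname{Re} z},$$ one has the resolvent lower bound $$\|(H-z)^{-1}\|\ \ge\ \frac1C\, e^{\sqrt{\operatorname{Re} z}/C}.$$ -/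

import Mathlib

open MeasureTheory TemperedDistribution
open scoped ENNReal SchwartzMap

noncomputable section

/-- The space `L²(ℝ) = L²(ℝ, dx; ℂ)`. -/
abbrev L2R : Type := Lp ℂ 2 (volume : Measure ℝ)

/-! ### Resolvent of an unbounded operator -/

section Resolvent

variable {E : Type*} [NormedAddCommGroup E] [NormedSpace ℂ E]

/-- `R` is the resolvent `(A - z)⁻¹`: a bounded everywhere defined operator which is a two-sided
inverse of `A - z : Dom A → E`. -/
def IsResolventAt (A : E →ₗ.[ℂ] E) (z : ℂ) (R : E →L[ℂ] E) : Prop :=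
  (∀ f : E, ∃ h : R f ∈ A.domain, A ⟨R f, h⟩ - z • R f = f) ∧
    ∀ ψ : A.domain, R (A ψ - z • (ψ : E)) = ψ

/-- The resolvent norm `‖(A - z)⁻¹‖ ∈ [0, ∞]`, with the usual convention that it is `∞` when `z`
lies in the spectrum of `A`. As the resolvent is unique, the infimum runs over at most one operator,
see `IsResolventAt.resolventNorm_eq` and `resolventNorm_eq_top`. -/
def resolventNorm (A : E →ₗ.[ℂ] E) (z : ℂ) : ℝ≥0∞ :=
  ⨅ (R : E →L[ℂ] E) (_ : IsResolventAt A z R), ‖R‖ₑ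

theorem IsResolventAt.unique {A : E →ₗ.[ℂ] E} {z : ℂ} {R S : E →L[ℂ] E}
    (hR : IsResolventAt A z R) (hS : IsResolventAt A z S) : R = S := by
  ext f
  obtain ⟨h, hf⟩ := hS.1 f
  have := hR.2 ⟨S f, h⟩
  rwa [hf] at this

theorem IsResolventAt.resolventNorm_eq {A : E →ₗ.[ℂ] E} {z : ℂ} {R : E →L[ℂ] E}
    (hR : IsResolventAt A z R) : resolventNorm A z = ‖R‖ₑ := by
  refine le_antisymm (iInf₂_le R hR) (le_iInf₂ fun S hS => ?_)
  rw [hR.unique hS]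

theorem resolventNorm_eq_top {A : E →ₗ.[ℂ] E} {z : ℂ}
    (h : ¬ ∃ R : E →L[ℂ] E, IsResolventAt A z R) : resolventNorm A z = ∞ := by
  refine le_antisymm le_top (le_iInf₂ fun S hS => absurd ⟨S, hS⟩ h)

end Resolvent

/-! ### The shifted harmonic oscillator -/

/-- The potential `x ↦ (x + i)²`. -/
def shiftedPotential (x : ℝ) : ℂ := ((x : ℂ) + Complex.I) ^ 2

theorem shiftedPotential_hasTemperateGrowth : shiftedPotential.HasTemperateGrowth := by
  have h : (fun x : ℝ => (x : ℂ) + Complex.I).HasTemperateGrowth :=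
    Function.HasTemperateGrowth.add Complex.ofRealCLM.hasTemperateGrowth
      (Function.HasTemperateGrowth.const _)
  have := h.mul h
  have he : shiftedPotential =
      (fun x : ℝ => (x : ℂ) + Complex.I) * (fun x : ℝ => (x : ℂ) + Complex.I) := by
    funext x
    simp only [shiftedPotential, sq, Pi.mul_apply]
  rw [he]
  exact this

/-- The differential expression `-d²/dx² + (x + i)²`, acting on tempered distributions. -/
def shiftedExpr : 𝓢'(ℝ, ℂ) →L[ℂ] 𝓢'(ℝ, ℂ) :=
  smulLeftCLM ℂ shiftedPotential - derivCLM ℂ ∘L derivCLM ℂ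

/-- The pairs `(ψ, f)` in `L²(ℝ) × L²(ℝ)` with `-ψ'' + (x + i)² ψ = f` in the sense of
distributions. -/
def shiftedGraph : Submodule ℂ (L2R × L2R) where
  carrier := {p | shiftedExpr (Lp.toTemperedDistributionCLM ℂ volume 2 p.1) =
    Lp.toTemperedDistributionCLM ℂ volume 2 p.2}
  add_mem' {p q} hp hq := by
    simp only [Set.mem_ofPred_eq, Prod.fst_add, Prod.snd_add, map_add] at hp hq ⊢
    rw [hp, hq]
  zero_mem' := by simp only [Set.mem_ofPred_eq, Prod.fst_zero, Prod.snd_zero, map_zero]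
  smul_mem' c p hp := by
    simp only [Set.mem_ofPred_eq, Prod.smul_fst, Prod.smul_snd, map_smul] at hp ⊢
    rw [hp]

/-- The shifted harmonic oscillator `H = -d²/dx² + (x + i)²` on `L²(ℝ)`, with its maximal domain
`Dom H = {ψ ∈ L²(ℝ) | -ψ'' + (x + i)² ψ ∈ L²(ℝ)}`. This is also the domain
`{ψ ∈ L²(ℝ) | -ψ'' + x² ψ ∈ L²(ℝ)} = {ψ ∈ W^{2,2}(ℝ) | x² ψ ∈ L²(ℝ)}` of the self-adjoint harmonic
oscillator. -/
def shiftedHO : L2R →ₗ.[ℂ] L2R := shiftedGraph.toLinearPMap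

theorem toTemperedDistributionCLM_injective :
    Function.Injective (Lp.toTemperedDistributionCLM ℂ (volume : Measure ℝ) 2) :=
  LinearMap.ker_eq_bot.mp
    (Lp.ker_toTemperedDistributionCLM_eq_bot (F := ℂ) (μ := (volume : Measure ℝ)) (p := 2))

theorem shiftedHO_graph : shiftedHO.graph = shiftedGraph := by
  refine Submodule.toLinearPMap_graph_eq _ fun p hp h0 => ?_
  apply toTemperedDistributionCLM_injective
  have hp' : shiftedExpr (Lp.toTemperedDistributionCLM ℂ volume 2 p.1) =
    Lp.toTemperedDistributionCLM ℂ volume 2 p.2 := hp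
  rw [← hp', h0, map_zero, map_zero]

/-- `ψ ∈ Dom H` and `H ψ = f` precisely when `-ψ'' + (x + i)² ψ = f` in the sense of
distributions. -/
theorem shiftedHO_eq_iff (ψ f : L2R) :
    (∃ h : ψ ∈ shiftedHO.domain, shiftedHO ⟨ψ, h⟩ = f) ↔
      shiftedExpr (ψ : 𝓢'(ℝ, ℂ)) = (f : 𝓢'(ℝ, ℂ)) := by
  have h1 : (ψ, f) ∈ shiftedHO.graph ↔ (ψ, f) ∈ shiftedGraph := by rw [shiftedHO_graph]
  refine Iff.trans ?_ h1
  rw [LinearPMap.mem_graph_iff]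
  constructor
  · rintro ⟨h, rfl⟩
    exact ⟨⟨ψ, h⟩, rfl, rfl⟩
  · rintro ⟨y, hy, hf⟩
    obtain ⟨y, hy'⟩ := y
    simp only at hy hf
    subst hy
    exact ⟨hy', hf⟩

end

/-! The Gaussians g_u(x) = exp(-(x+i)²/2 + u(x+i) - u²/4) are generating functions of the shifted
Hermite functions, so H acts on them as a first-order operator in the parameter: H g_u = 2u ∂_u g_u
+ g_u. If R = (H - z)⁻¹ exists, then along the classical rotation u(t) = u e^{-2it} one gets d/dt
[e^{i(z-1)t} R g_{u(t)}] = -i e^{i(z-1)t} g_{u(t)}. No semigroup is needed, only weak holomorphy of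
u ↦ g_u.

Pair with the complex conjugate of g_v, where uv = z - 1, and integrate over [-T, T]. The pairing of
conj g_v with g_u is √π e^{uv/2}, so the source becomes an explicit oscillatory integral of
exp((z-1)(it + e^{-2it}/2)). Its critical point t = 0 has critical value 1/2, so with a = (Re z -
1)/2 and ℓ = √(Re z) its modulus is at least e^a/(18ℓ) (`norm_integral_evolution_ge`).

The two boundary terms are at most ‖R‖ times norms of coherent states
(`IsResolventAt.norm_integral_le`). For suitable u, v these norms multiply to O(e^a) at t = 0, and
moving to t = ±T gains a factor e^{-cℓ} (`coherent_exponent_le`). The gain comes from s² = |z-1| -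
(Im z)²/4, and s is comparable to ℓ exactly because |Im z| stays a factor 1-ε below 2ℓ. Comparing
the two bounds forces ‖R‖ to be exponentially large in ℓ. -/

/-! ### Coherent states: Gaussian bounds and holomorphy in the parameter -/

/-- The coherent state with complex parameter `u`, translated by `i`. -/
noncomputable def shiftedCoherent (u : ℂ) (x : ℝ) : ℂ :=
  Complex.exp (-((x : ℂ) + Complex.I) ^ 2 / 2 + u * ((x : ℂ) + Complex.I) - u ^ 2 / 4)

/-- The derivative of `shiftedCoherent u x` in the parameter `u`. -/
noncomputable def shiftedCoherentDeriv (u : ℂ) (x : ℝ) : ℂ :=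
  ((x : ℂ) + Complex.I - u / 2) * shiftedCoherent u x

theorem continuous_shiftedCoherent (u : ℂ) : Continuous (shiftedCoherent u) := by
  unfold shiftedCoherent; fun_prop

theorem continuous_shiftedCoherentDeriv (u : ℂ) : Continuous (shiftedCoherentDeriv u) := by
  have := continuous_shiftedCoherent u
  unfold shiftedCoherentDeriv; fun_prop

theorem norm_shiftedCoherent (u : ℂ) (x : ℝ) :
    ‖shiftedCoherent u x‖ =
      Real.exp (-x ^ 2 / 2 + 1 / 2 + u.re * x - u.im - (u.re ^ 2 - u.im ^ 2) / 4) := by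
  rw [shiftedCoherent, Complex.norm_exp]
  congr 1
  have h1 : (-((x : ℂ) + Complex.I) ^ 2 / 2 + u * ((x : ℂ) + Complex.I) - u ^ 2 / 4) =
      ((-1 / 2 : ℝ) : ℂ) * ((x : ℂ) + Complex.I) ^ 2 + u * ((x : ℂ) + Complex.I)
        - ((1 / 4 : ℝ) : ℂ) * u ^ 2 := by
    push_cast; ring
  rw [h1, Complex.sub_re, Complex.add_re, Complex.re_ofReal_mul, Complex.re_ofReal_mul]
  simp [sq]
  ring

/-- Locally uniform domination of the coherent states by a fixed Gaussian. -/
theorem shiftedCoherent_bound (B : ℝ) :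
    ∃ C : ℝ, 0 ≤ C ∧ ∀ u : ℂ, ‖u‖ ≤ B → ∀ x : ℝ,
      (1 + |x|) ^ 2 * ‖shiftedCoherent u x‖ ≤ C * Real.exp (-(1 / 4) * x ^ 2) := by
  -- The term (B+2)² comes from completing the square: (B+2)|x| ≤ x²/4 + (B+2)². Here B|x| bounds
  -- `u.re * x` and 2|x| absorbs the polynomial weight.
  refine ⟨Real.exp (1 / 2 + B + B ^ 2 / 4 + (B + 2) ^ 2), (Real.exp_pos _).le, fun u hu x => ?_⟩
  have h1 : (1 + |x|) ^ 2 ≤ Real.exp (2 * |x|) := by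
    rw [two_mul, Real.exp_add, ← sq]
    exact pow_le_pow_left₀ (by positivity) (by linarith [Real.add_one_le_exp |x|]) 2
  have hre : u.re * x ≤ B * |x| := by
    refine (le_abs_self _).trans ?_
    rw [abs_mul]
    exact mul_le_mul_of_nonneg_right ((Complex.abs_re_le_norm u).trans hu) (abs_nonneg x)
  have him : |u.im| ≤ B := (Complex.abs_im_le_norm u).trans hu
  have him' := neg_le_of_abs_le him
  have him2 : u.im ^ 2 ≤ B ^ 2 := by
    rw [← sq_abs]; exact pow_le_pow_left₀ (abs_nonneg _) him 2
  rw [norm_shiftedCoherent, ← Real.exp_add]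
  refine (mul_le_mul_of_nonneg_right h1 (Real.exp_pos _).le).trans ?_
  rw [← Real.exp_add, Real.exp_le_exp]
  nlinarith [sq_nonneg (|x| / 2 - (B + 2)), sq_abs x, sq_nonneg u.re]

theorem memLp_two_of_le_gaussian {f : ℝ → ℂ} (hf : Continuous f) {C : ℝ}
    (h : ∀ x, ‖f x‖ ≤ C * Real.exp (-(1 / 4) * x ^ 2)) : MemLp f 2 volume := by
  have hg : MemLp (fun x : ℝ => C * Real.exp (-(1 / 4) * x ^ 2)) 2 volume := by
    refine MemLp.const_mul ?_ C
    rw [memLp_two_iff_integrable_sq (by fun_prop)]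
    have : Integrable fun x : ℝ => Real.exp (-(1 / 2) * x ^ 2) :=
      integrable_exp_neg_mul_sq (by norm_num)
    refine this.congr (Filter.Eventually.of_forall fun x => ?_)
    simp only
    rw [← Real.exp_nat_mul]
    congr 1; push_cast; ring
  exact hg.of_le hf.aestronglyMeasurable (Filter.Eventually.of_forall fun x =>
    (h x).trans (le_abs_self _))

theorem integrable_of_le_gaussian {f : ℝ → ℂ} (hf : Continuous f) {C : ℝ}
    (h : ∀ x, ‖f x‖ ≤ C * Real.exp (-(1 / 4) * x ^ 2)) : Integrable f volume :=
  ((integrable_exp_neg_mul_sq (b := 1 / 4) (by norm_num)).const_mul C).mono'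
    hf.aestronglyMeasurable (Filter.Eventually.of_forall h)

/-- A function bounded by a quadratic polynomial times a coherent state is dominated by a fixed
Gaussian. -/
theorem exists_gaussian_bound {f : ℝ → ℂ} {u : ℂ} {D : ℝ} (hD : 0 ≤ D)
    (h : ∀ x, ‖f x‖ ≤ D * (1 + |x|) ^ 2 * ‖shiftedCoherent u x‖) :
    ∃ C : ℝ, ∀ x, ‖f x‖ ≤ C * Real.exp (-(1 / 4) * x ^ 2) := by
  obtain ⟨C, -, hC⟩ := shiftedCoherent_bound ‖u‖
  refine ⟨D * C, fun x => (h x).trans ?_⟩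
  rw [mul_assoc, mul_assoc]
  exact mul_le_mul_of_nonneg_left (hC u le_rfl x) hD

theorem norm_shiftedCoherentDeriv_le (u : ℂ) (x : ℝ) :
    ‖shiftedCoherentDeriv u x‖ ≤ (1 + ‖u‖) * (1 + |x|) ^ 2 * ‖shiftedCoherent u x‖ := by
  rw [shiftedCoherentDeriv, norm_mul]
  refine mul_le_mul_of_nonneg_right ?_ (norm_nonneg _)
  have h1 : ‖(x : ℂ) + Complex.I - u / 2‖ ≤ |x| + 1 + ‖u‖ / 2 := by
    refine (norm_sub_le _ _).trans (add_le_add ((norm_add_le _ _).trans ?_) ?_)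
    · simp
    · simp
  nlinarith [abs_nonneg x, norm_nonneg u, mul_nonneg (norm_nonneg u) (abs_nonneg x),
    mul_nonneg (norm_nonneg u) (sq_nonneg |x|), sq_nonneg |x|]

theorem memLp_shiftedCoherent (u : ℂ) : MemLp (shiftedCoherent u) 2 volume := by
  obtain ⟨C, hC⟩ := exists_gaussian_bound (f := shiftedCoherent u) (u := u) zero_le_one
    (fun x => by
      rw [one_mul]
      exact le_mul_of_one_le_left (norm_nonneg _)
        (one_le_pow₀ (by linarith [abs_nonneg x])))
  exact memLp_two_of_le_gaussian (continuous_shiftedCoherent u) hC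

theorem memLp_shiftedCoherentDeriv (u : ℂ) : MemLp (shiftedCoherentDeriv u) 2 volume := by
  obtain ⟨C, hC⟩ := exists_gaussian_bound (f := shiftedCoherentDeriv u) (u := u)
    (by positivity) (norm_shiftedCoherentDeriv_le u)
  exact memLp_two_of_le_gaussian (continuous_shiftedCoherentDeriv u) hC

/-- The coherent state as an element of `L²(ℝ)`. -/
noncomputable def coherentL2 (u : ℂ) : L2R := (memLp_shiftedCoherent u).toLp _

/-- The parameter derivative of the coherent state as an element of `L²(ℝ)`. -/
noncomputable def coherentDerivL2 (u : ℂ) : L2R := (memLp_shiftedCoherentDeriv u).toLp _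

theorem hasDerivAt_shiftedCoherent (x : ℝ) (u : ℂ) :
    HasDerivAt (fun w => shiftedCoherent w x) (shiftedCoherentDeriv u x) u := by
  unfold shiftedCoherentDeriv shiftedCoherent
  have h : HasDerivAt (fun w : ℂ => -((x : ℂ) + Complex.I) ^ 2 / 2 + w * ((x : ℂ) + Complex.I)
      - w ^ 2 / 4) ((x : ℂ) + Complex.I - u / 2) u := by
    have h1 := ((hasDerivAt_id u).mul_const ((x : ℂ) + Complex.I)).const_add
      (-((x : ℂ) + Complex.I) ^ 2 / 2)
    have h2 := ((hasDerivAt_id u).pow 2).div_const 4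
    refine (h1.sub h2).congr_deriv ?_
    simp; ring
  refine h.cexp.congr_deriv ?_
  ring

/-- The coherent states depend weakly holomorphically on their parameter. -/
theorem hasDerivAt_clm_coherentL2 (l : L2R →L[ℂ] ℂ) (u : ℂ) :
    HasDerivAt (fun w => l (coherentL2 w)) (l (coherentDerivL2 u)) u := by
  obtain ⟨k, rfl⟩ := (InnerProductSpace.toDual ℂ L2R).surjective l
  simp only [InnerProductSpace.toDual_apply_apply, L2.inner_def]
  have e1 : ∀ w, ∫ a, inner ℂ (k a) (coherentL2 w a) =
      ∫ a, inner ℂ (k a) (shiftedCoherent w a) := fun w =>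
    integral_congr_ae ((memLp_shiftedCoherent w).coeFn_toLp.mono fun a ha => by
      simp only [coherentL2]; rw [ha])
  have e2 : ∫ a, inner ℂ (k a) (coherentDerivL2 u a) =
      ∫ a, inner ℂ (k a) (shiftedCoherentDeriv u a) :=
    integral_congr_ae ((memLp_shiftedCoherentDeriv u).coeFn_toLp.mono fun a ha => by
      simp only [coherentDerivL2]; rw [ha])
  simp only [e1, e2]
  obtain ⟨C, hC0, hC⟩ := shiftedCoherent_bound (‖u‖ + 1)
  have hk : MemLp (fun a => k a) 2 volume := Lp.memLp k
  have hgauss : MemLp (fun x : ℝ => (((‖u‖ + 2) * C * Real.exp (-(1 / 4) * x ^ 2) : ℝ) : ℂ)) 2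
      volume :=
    memLp_two_of_le_gaussian (by fun_prop) (C := (‖u‖ + 2) * C) fun x => by
      rw [Complex.norm_real, Real.norm_of_nonneg (by positivity)]
  have hb : Integrable (fun a : ℝ =>
      ‖k a‖ * ((‖u‖ + 2) * C * Real.exp (-(1 / 4) * a ^ 2))) volume := by
    have := hk.norm.integrable_mul hgauss.norm
    refine this.congr (Filter.Eventually.of_forall fun x => ?_)
    simp only [Pi.mul_apply]
    rw [Complex.norm_real, Real.norm_of_nonneg (by positivity)]
  refine (hasDerivAt_integral_of_dominated_loc_of_deriv_le (Metric.ball_mem_nhds u one_pos)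
    (F := fun w a => inner ℂ (k a) (shiftedCoherent w a))
    (F' := fun w a => inner ℂ (k a) (shiftedCoherentDeriv w a))
    (Filter.Eventually.of_forall fun w => hk.1.inner
      (continuous_shiftedCoherent w).aestronglyMeasurable) ?_
    (hk.1.inner (continuous_shiftedCoherentDeriv u).aestronglyMeasurable)
    (Filter.Eventually.of_forall fun a w hw => ?_) hb
    (Filter.Eventually.of_forall fun a w _ => ?_)).2
  · have := L2.integrable_inner (𝕜 := ℂ) k (coherentL2 u)
    refine this.congr ((memLp_shiftedCoherent u).coeFn_toLp.mono fun a ha => ?_)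
    simp only [coherentL2]; rw [ha]
  · have hw' : ‖w‖ ≤ ‖u‖ + 1 := by
      have := norm_sub_norm_le w u
      have h2 : ‖w - u‖ < 1 := by simpa [dist_eq_norm] using hw
      linarith
    refine (norm_inner_le_norm _ _).trans (mul_le_mul_of_nonneg_left ?_ (norm_nonneg _))
    refine (norm_shiftedCoherentDeriv_le w a).trans ?_
    rw [mul_assoc, mul_assoc]
    exact mul_le_mul (by linarith) (hC w hw' a) (by positivity) (by positivity)
  · have := (hasDerivAt_shiftedCoherent a w).const_mul (starRingEnd ℂ (k a))
    simpa only [RCLike.inner_apply, mul_comm] using this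

/-! ### The operator on coherent states, in the sense of distributions -/

theorem hasDerivAt_shiftedCoherent_position (u : ℂ) (x : ℝ) :
    HasDerivAt (shiftedCoherent u)
      ((u - ((x : ℂ) + Complex.I)) * shiftedCoherent u x) x := by
  unfold shiftedCoherent
  have hy : HasDerivAt (fun y : ℝ => (y : ℂ) + Complex.I) 1 x :=
    (Complex.ofRealCLM.hasDerivAt (x := x)).add_const _
  have h : HasDerivAt (fun y : ℝ => -((y : ℂ) + Complex.I) ^ 2 / 2 + u * ((y : ℂ) + Complex.I)
      - u ^ 2 / 4) (u - ((x : ℂ) + Complex.I)) x := by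
    refine ((((hy.pow 2).neg.div_const 2).add (hy.const_mul u)).sub_const _).congr_deriv ?_
    simp; ring
  refine h.cexp.congr_deriv ?_
  ring

theorem hasDerivAt_shiftedCoherent_position' (u : ℂ) (x : ℝ) :
    HasDerivAt (fun y : ℝ => (u - ((y : ℂ) + Complex.I)) * shiftedCoherent u y)
      (((u - ((x : ℂ) + Complex.I)) ^ 2 - 1) * shiftedCoherent u x) x := by
  have hy : HasDerivAt (fun y : ℝ => u - ((y : ℂ) + Complex.I)) (-1) x :=
    ((Complex.ofRealCLM.hasDerivAt (x := x)).add_const _).const_sub _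
  refine (hy.mul (hasDerivAt_shiftedCoherent_position u x)).congr_deriv ?_
  ring

theorem integrable_schwartz_mul {f : ℝ → ℂ} (hf : Integrable f) (φ : 𝓢(ℝ, ℂ)) :
    Integrable fun x => φ x * f x := by
  obtain ⟨C, hC⟩ := φ.decay 0 0
  refine hf.bdd_mul (c := C) φ.continuous.aestronglyMeasurable
    (Filter.Eventually.of_forall fun x => ?_)
  simpa using hC.2 x

theorem integrable_poly_mul_shiftedCoherent {p : ℝ → ℂ} (hp : Continuous p) (u : ℂ) {D : ℝ}
    (hD : 0 ≤ D) (h : ∀ x, ‖p x‖ ≤ D * (1 + |x|) ^ 2) :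
    Integrable fun x => p x * shiftedCoherent u x := by
  obtain ⟨C, hC⟩ := exists_gaussian_bound (f := fun x => p x * shiftedCoherent u x) (u := u) hD
    (fun x => by
      rw [norm_mul]
      exact mul_le_mul_of_nonneg_right (h x) (norm_nonneg _))
  exact integrable_of_le_gaussian (hp.mul (continuous_shiftedCoherent u)) hC

theorem norm_sub_shift_le (u : ℂ) (x : ℝ) :
    ‖u - ((x : ℂ) + Complex.I)‖ ≤ (1 + ‖u‖) * (1 + |x|) := by
  refine (norm_sub_le _ _).trans ((add_le_add_right (norm_add_le _ _) _).trans ?_)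
  simp only [Complex.norm_real, Real.norm_eq_abs, Complex.norm_I]
  nlinarith [abs_nonneg x, norm_nonneg u, mul_nonneg (norm_nonneg u) (abs_nonneg x)]

theorem integrable_shiftedCoherent (u : ℂ) : Integrable (shiftedCoherent u) := by
  have := integrable_poly_mul_shiftedCoherent (p := fun _ => 1) continuous_const u zero_le_one
    (fun x => by
      rw [one_mul, norm_one]
      exact one_le_pow₀ (by linarith [abs_nonneg x]))
  simpa using this

theorem integrable_shiftedCoherent_deriv1 (u : ℂ) :
    Integrable fun x : ℝ => (u - ((x : ℂ) + Complex.I)) * shiftedCoherent u x :=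
  integrable_poly_mul_shiftedCoherent (by fun_prop) u (D := 1 + ‖u‖) (by positivity) fun x =>
    (norm_sub_shift_le u x).trans (mul_le_mul_of_nonneg_left
      (le_self_pow₀ (by linarith [abs_nonneg x]) two_ne_zero) (by positivity))

theorem integrable_shiftedCoherent_deriv2 (u : ℂ) :
    Integrable fun x : ℝ => ((u - ((x : ℂ) + Complex.I)) ^ 2 - 1) * shiftedCoherent u x := by
  have h : Integrable fun x : ℝ => (u - ((x : ℂ) + Complex.I)) ^ 2 * shiftedCoherent u x :=
    integrable_poly_mul_shiftedCoherent (by fun_prop) u (D := (1 + ‖u‖) ^ 2) (by positivity)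
      fun x => by
        rw [norm_pow, ← mul_pow]
        exact pow_le_pow_left₀ (norm_nonneg _) (norm_sub_shift_le u x) 2
  refine (h.sub (integrable_shiftedCoherent u)).congr (Filter.Eventually.of_forall fun x => ?_)
  simp only [Pi.sub_apply]; ring

theorem integral_deriv2_schwartz_mul_shiftedCoherent (u : ℂ) (φ : 𝓢(ℝ, ℂ)) :
    ∫ x, (SchwartzMap.derivCLM ℂ ℂ (SchwartzMap.derivCLM ℂ ℂ φ)) x * shiftedCoherent u x =
      ∫ x : ℝ, φ x * (((u - ((x : ℂ) + Complex.I)) ^ 2 - 1) * shiftedCoherent u x) := by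
  have hd : ∀ (ψ : 𝓢(ℝ, ℂ)) (x : ℝ), HasDerivAt ψ (SchwartzMap.derivCLM ℂ ℂ ψ x) x := fun ψ x => by
    rw [SchwartzMap.derivCLM_apply]
    exact ψ.differentiableAt.hasDerivAt
  have h1 := integral_mul_deriv_eq_deriv_mul_of_integrable
    (u := φ) (v := fun x : ℝ => (u - ((x : ℂ) + Complex.I)) * shiftedCoherent u x)
    (fun x _ => hd φ x) (fun x _ => hasDerivAt_shiftedCoherent_position' u x)
    (integrable_schwartz_mul (integrable_shiftedCoherent_deriv2 u) φ)
    (integrable_schwartz_mul (integrable_shiftedCoherent_deriv1 u) _)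
    (integrable_schwartz_mul (integrable_shiftedCoherent_deriv1 u) φ)
  have h2 := integral_mul_deriv_eq_deriv_mul_of_integrable
    (u := SchwartzMap.derivCLM ℂ ℂ φ) (v := shiftedCoherent u)
    (fun x _ => hd _ x) (fun x _ => hasDerivAt_shiftedCoherent_position u x)
    (integrable_schwartz_mul (integrable_shiftedCoherent_deriv1 u) _)
    (integrable_schwartz_mul (integrable_shiftedCoherent u) _)
    (integrable_schwartz_mul (integrable_shiftedCoherent u) _)
  rw [h1, h2, neg_neg]

/-- With y = x + i, g'' = ((u-y)² - 1) g, so -g'' + y² g = (2uy - u² + 1) g = 2u(y - u/2) g + g. Two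
integrations by parts against a Schwartz function make this distributional. -/
theorem shiftedExpr_coherentL2 (u : ℂ) :
    shiftedExpr (coherentL2 u : 𝓢'(ℝ, ℂ)) =
      (((2 * u) • coherentDerivL2 u + coherentL2 u : L2R) : 𝓢'(ℝ, ℂ)) := by
  ext φ
  have hV := shiftedPotential_hasTemperateGrowth
  have hint := integrable_schwartz_mul (integrable_shiftedCoherent u)
    (SchwartzMap.smulLeftCLM ℂ shiftedPotential φ)
  have hint2 := integrable_schwartz_mul (integrable_shiftedCoherent_deriv2 u) φ
  have hae : ∀ ψ : 𝓢(ℝ, ℂ), ∫ x, ψ x • coherentL2 u x = ∫ x, ψ x * shiftedCoherent u x :=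
    fun ψ => integral_congr_ae ((memLp_shiftedCoherent u).coeFn_toLp.mono fun a ha => by
      simp only [coherentL2, smul_eq_mul]; rw [ha])
  have hR : ∫ x, φ x • ((2 * u) • coherentDerivL2 u + coherentL2 u : L2R) x =
      ∫ x, φ x * ((2 * u * ((x : ℂ) + Complex.I - u / 2) + 1) * shiftedCoherent u x) := by
    refine integral_congr_ae ?_
    filter_upwards [Lp.coeFn_add ((2 * u) • coherentDerivL2 u) (coherentL2 u),
      Lp.coeFn_smul (2 * u) (coherentDerivL2 u), (memLp_shiftedCoherent u).coeFn_toLp,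
      (memLp_shiftedCoherentDeriv u).coeFn_toLp] with x h1 h2 h3 h4
    rw [h1, Pi.add_apply, h2, Pi.smul_apply]
    simp only [coherentL2, coherentDerivL2, smul_eq_mul]
    rw [h3, h4, shiftedCoherentDeriv]
    ring
  have hL : shiftedExpr (coherentL2 u : 𝓢'(ℝ, ℂ)) φ =
      (∫ x, (SchwartzMap.smulLeftCLM ℂ shiftedPotential φ) x * shiftedCoherent u x) -
      ∫ x, (SchwartzMap.derivCLM ℂ ℂ (SchwartzMap.derivCLM ℂ ℂ φ)) x * shiftedCoherent u x := by
    rw [← hae, ← hae, ← Lp.toTemperedDistribution_apply, ← Lp.toTemperedDistribution_apply]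
    have : shiftedExpr (coherentL2 u : 𝓢'(ℝ, ℂ)) φ =
      (coherentL2 u : 𝓢'(ℝ, ℂ)) (SchwartzMap.smulLeftCLM ℂ shiftedPotential φ) -
      (coherentL2 u : 𝓢'(ℝ, ℂ))
        (-SchwartzMap.derivCLM ℂ ℂ (-SchwartzMap.derivCLM ℂ ℂ φ)) := rfl
    rw [this]
    simp only [map_neg, neg_neg]
  rw [hL, Lp.toTemperedDistribution_apply, hR, integral_deriv2_schwartz_mul_shiftedCoherent,
    ← integral_sub hint hint2]
  refine integral_congr_ae (Filter.Eventually.of_forall fun x => ?_)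
  simp only [SchwartzMap.smulLeftCLM_apply_apply hV, smul_eq_mul, shiftedPotential]
  ring

/-- Only the left-inverse property R(H - z) = 1 is needed; it yields a first-order differential
equation in u for R g_u. -/
theorem IsResolventAt.apply_coherentL2 {z : ℂ} {R : L2R →L[ℂ] L2R}
    (hR : IsResolventAt shiftedHO z R) (u : ℂ) :
    (2 * u) • R (coherentDerivL2 u) + (1 - z) • R (coherentL2 u) = coherentL2 u := by
  obtain ⟨h, hH⟩ := (shiftedHO_eq_iff _ _).2 (shiftedExpr_coherentL2 u)
  have h2 := hR.2 ⟨coherentL2 u, h⟩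
  rw [hH] at h2
  simp only [map_sub, map_add, map_smul] at h2
  rw [sub_smul, one_smul]
  rw [add_sub_assoc] at h2
  exact h2

/-! ### Gaussian integrals: norms and pairings -/

theorem integral_cexp_neg_sq (c d : ℂ) :
    ∫ x : ℝ, Complex.exp (-1 * (x : ℂ) ^ 2 + c * x + d) =
      (Real.sqrt Real.pi : ℂ) * Complex.exp (d + c ^ 2 / 4) := by
  rw [integral_cexp_quadratic (by simp) c d]
  congr 1
  · rw [neg_neg, div_one, Real.sqrt_eq_rpow, Complex.ofReal_cpow Real.pi_pos.le]
    norm_num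
  · congr 1; ring

theorem norm_coherentL2 (u : ℂ) :
    ‖coherentL2 u‖ =
      Real.sqrt (Real.sqrt Real.pi * Real.exp (‖u‖ ^ 2 / 2 - 2 * u.im + 1)) := by
  have h1 : (inner ℂ (coherentL2 u) (coherentL2 u) : ℂ) =
      ((Real.sqrt Real.pi * Real.exp (‖u‖ ^ 2 / 2 - 2 * u.im + 1) : ℝ) : ℂ) := by
    rw [L2.inner_def]
    have : ∫ a, inner ℂ (coherentL2 u a) (coherentL2 u a) =
        ∫ a : ℝ, Complex.exp (-1 * (a : ℂ) ^ 2 + ((2 * u.re : ℝ) : ℂ) * a +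
          ((1 - 2 * u.im - (u.re ^ 2 - u.im ^ 2) / 2 : ℝ) : ℂ)) := by
      refine integral_congr_ae ((memLp_shiftedCoherent u).coeFn_toLp.mono fun a ha => ?_)
      simp only [coherentL2]
      rw [ha, inner_self_eq_norm_sq_to_K, norm_shiftedCoherent]
      simp only [Complex.coe_algebraMap]
      rw [← Complex.ofReal_pow, ← Real.exp_nat_mul, Complex.ofReal_exp]
      congr 1
      push_cast; ring
    rw [this, integral_cexp_neg_sq]
    push_cast
    congr 2
    have : (‖u‖ : ℂ) ^ 2 = (u.re : ℂ) ^ 2 + (u.im : ℂ) ^ 2 := by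
      rw [← Complex.ofReal_pow, Complex.sq_norm, Complex.normSq_apply]
      push_cast; ring
    rw [this]; ring
  rw [inner_self_eq_norm_sq_to_K] at h1
  have h2 : ‖coherentL2 u‖ ^ 2 = Real.sqrt Real.pi * Real.exp (‖u‖ ^ 2 / 2 - 2 * u.im + 1) :=
    Complex.ofReal_injective ((Complex.ofReal_pow _ _).trans h1)
  rw [← h2, Real.sqrt_sq (norm_nonneg _)]

theorem memLp_conj_shiftedCoherent (v : ℂ) :
    MemLp (fun x => starRingEnd ℂ (shiftedCoherent v x)) 2 volume :=
  (memLp_shiftedCoherent v).of_le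
    (Complex.continuous_conj.comp (continuous_shiftedCoherent v)).aestronglyMeasurable
    (Filter.Eventually.of_forall fun x => by simp)

/-- The complex conjugate of a coherent state as an element of `L²(ℝ)`. -/
noncomputable def conjCoherentL2 (v : ℂ) : L2R := (memLp_conj_shiftedCoherent v).toLp _

theorem norm_conjCoherentL2 (v : ℂ) : ‖conjCoherentL2 v‖ = ‖coherentL2 v‖ := by
  rw [conjCoherentL2, coherentL2, Lp.norm_toLp, Lp.norm_toLp]
  congr 1
  exact eLpNorm_congr_norm_ae (Filter.Eventually.of_forall fun x => by simp)

/-- Conjugating one factor makes the pairing bilinear, hence holomorphic in u and v; the shift by i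
drops out of it, while in the norms it survives as the terms -2 Im u + 1. -/
theorem inner_conjCoherentL2 (v u : ℂ) :
    (inner ℂ (conjCoherentL2 v) (coherentL2 u) : ℂ) =
      (Real.sqrt Real.pi : ℂ) * Complex.exp (u * v / 2) := by
  rw [L2.inner_def]
  have : ∫ a, inner ℂ (conjCoherentL2 v a) (coherentL2 u a) =
      ∫ a : ℝ, Complex.exp (-1 * (a : ℂ) ^ 2 + (u + v - 2 * Complex.I) * a +
        (1 + (u + v) * Complex.I - u ^ 2 / 4 - v ^ 2 / 4)) := by
    refine integral_congr_ae ?_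
    filter_upwards [(memLp_shiftedCoherent u).coeFn_toLp,
      (memLp_conj_shiftedCoherent v).coeFn_toLp] with a h1 h2
    simp only [coherentL2, conjCoherentL2]
    rw [h1, h2, RCLike.inner_apply, starRingEnd_self_apply, shiftedCoherent, shiftedCoherent,
      ← Complex.exp_add]
    congr 1
    linear_combination -Complex.I_sq
  rw [this, integral_cexp_neg_sq]
  congr 2
  linear_combination Complex.I_sq

theorem norm_mul_norm_coherentL2 (u v : ℂ) :
    ‖conjCoherentL2 v‖ * ‖coherentL2 u‖ =
      Real.sqrt Real.pi * Real.exp ((‖u‖ ^ 2 + ‖v‖ ^ 2) / 4 - v.im - u.im + 1) := by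
  rw [norm_conjCoherentL2, norm_coherentL2, norm_coherentL2, ← Real.sqrt_mul (by positivity),
    Real.sqrt_eq_iff_mul_self_eq (by positivity) (by positivity)]
  have : ∀ a b c s : ℝ, a + b = c + c →
      s * Real.exp c * (s * Real.exp c) = s * Real.exp a * (s * Real.exp b) := by
    intro a b c s h
    have h2 := congrArg Real.exp h
    rw [Real.exp_add, Real.exp_add] at h2
    linear_combination -s ^ 2 * h2
  exact (this _ _ _ _ (by ring)).symm

/-! ### The evolution identity and its boundary terms -/

/-- The pairing of the resolvent with the evolved coherent state, and its time derivative. -/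
theorem IsResolventAt.hasDerivAt_evolution {z : ℂ} {R : L2R →L[ℂ] L2R}
    (hR : IsResolventAt shiftedHO z R) {u v : ℂ} (huv : u * v = z - 1) (t : ℝ) :
    HasDerivAt (fun t : ℝ => Complex.exp (Complex.I * (z - 1) * t) *
        inner ℂ (conjCoherentL2 v) (R (coherentL2 (u * Complex.exp (-2 * Complex.I * t)))))
      (-Complex.I * (Real.sqrt Real.pi : ℂ) *
        Complex.exp ((z - 1) * (Complex.I * t + Complex.exp (-2 * Complex.I * t) / 2))) t := by
  set l : L2R →L[ℂ] ℂ := (innerSL ℂ (conjCoherentL2 v)).comp R with hl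
  have hlin : ∀ c : ℂ, HasDerivAt (fun t : ℝ => c * (t : ℂ)) c t := fun c => by
    simpa using (Complex.ofRealCLM.hasDerivAt (x := t)).const_mul c
  have h1 := (hlin (Complex.I * (z - 1))).cexp
  have h2 := ((hlin (-2 * Complex.I)).cexp).const_mul u
  have h3 := (hasDerivAt_clm_coherentL2 l _).comp t h2
  set w := u * Complex.exp (-2 * Complex.I * t) with hw
  have hres := congrArg (inner ℂ (conjCoherentL2 v)) (hR.apply_coherentL2 w)
  rw [inner_add_right, inner_smul_right, inner_smul_right, inner_conjCoherentL2] at hres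
  have hl' : ∀ f, l f = inner ℂ (conjCoherentL2 v) (R f) := fun f => rfl
  refine (h1.mul h3).congr_deriv ?_
  simp only [Function.comp_apply, ← hw, hl']
  have hexp : Complex.exp ((z - 1) * (Complex.I * t + Complex.exp (-2 * Complex.I * t) / 2)) =
      Complex.exp (Complex.I * (z - 1) * t) * Complex.exp (w * v / 2) := by
    rw [← Complex.exp_add]
    congr 1
    rw [hw, ← huv]; ring
  rw [hexp]
  linear_combination (-Complex.I * Complex.exp (Complex.I * (z - 1) * t)) * hres

/-- The fundamental theorem of calculus for the evolved pairing, with Cauchy–Schwarz at t = ±T. The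
rotation preserves |u(t)|, so only Im u(t) changes in the norms; the common factor √π cancels. -/
theorem IsResolventAt.norm_integral_le {z : ℂ} {R : L2R →L[ℂ] L2R}
    (hR : IsResolventAt shiftedHO z R) {u v : ℂ} (huv : u * v = z - 1) (T : ℝ) :
    ‖∫ t in (-T)..T,
        Complex.exp ((z - 1) * (Complex.I * t + Complex.exp (-2 * Complex.I * t) / 2))‖ ≤
      ‖R‖ * (Real.exp ((‖u‖ ^ 2 + ‖v‖ ^ 2) / 4 - v.im + 1) *
        (Real.exp (-T * z.im - (u * Complex.exp (-2 * Complex.I * T)).im) +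
         Real.exp (T * z.im - (u * Complex.exp (2 * Complex.I * T)).im))) := by
  have hftc := intervalIntegral.integral_eq_sub_of_hasDerivAt (a := -T) (b := T)
    (fun t _ => hR.hasDerivAt_evolution huv t)
    (Continuous.intervalIntegrable (by fun_prop) _ _)
  rw [intervalIntegral.integral_const_mul] at hftc
  have hpi : 0 < Real.sqrt Real.pi := Real.sqrt_pos.2 Real.pi_pos
  have hbd : ∀ t : ℝ, ‖Complex.exp (Complex.I * (z - 1) * t) *
        inner ℂ (conjCoherentL2 v) (R (coherentL2 (u * Complex.exp (-2 * Complex.I * t))))‖ ≤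
      Real.sqrt Real.pi * (‖R‖ * (Real.exp ((‖u‖ ^ 2 + ‖v‖ ^ 2) / 4 - v.im + 1) *
        Real.exp (-t * z.im - (u * Complex.exp (-2 * Complex.I * t)).im))) := fun t => by
    have hn : ‖u * Complex.exp (-2 * Complex.I * t)‖ = ‖u‖ := by
      rw [norm_mul, Complex.norm_exp]; simp
    have he : ‖Complex.exp (Complex.I * (z - 1) * t)‖ = Real.exp (-t * z.im) := by
      rw [Complex.norm_exp]; congr 1; simp; ring
    have hin : ‖(inner ℂ (conjCoherentL2 v)
        (R (coherentL2 (u * Complex.exp (-2 * Complex.I * t)))) : ℂ)‖ ≤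
        ‖R‖ * (‖conjCoherentL2 v‖ * ‖coherentL2 (u * Complex.exp (-2 * Complex.I * t))‖) := by
      refine (norm_inner_le_norm _ _).trans ?_
      refine (mul_le_mul_of_nonneg_left (R.le_opNorm _) (norm_nonneg _)).trans_eq ?_
      ring
    rw [norm_mul, he]
    refine (mul_le_mul_of_nonneg_left hin (Real.exp_pos _).le).trans_eq ?_
    rw [norm_mul_norm_coherentL2, hn,
      show (‖u‖ ^ 2 + ‖v‖ ^ 2) / 4 - v.im - (u * Complex.exp (-2 * Complex.I * t)).im + 1 =
        ((‖u‖ ^ 2 + ‖v‖ ^ 2) / 4 - v.im + 1) + -(u * Complex.exp (-2 * Complex.I * t)).im by ring,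
      Real.exp_add, show -t * z.im - (u * Complex.exp (-2 * Complex.I * t)).im =
        -t * z.im + -(u * Complex.exp (-2 * Complex.I * t)).im by ring, Real.exp_add (-t * z.im)]
    ring
  have hn := congrArg norm hftc
  rw [norm_mul, norm_mul, norm_neg, Complex.norm_I, one_mul, Complex.norm_real,
    Real.norm_of_nonneg hpi.le] at hn
  refine le_of_mul_le_mul_left ?_ hpi
  rw [hn]
  refine (norm_sub_le _ _).trans ((add_le_add (hbd T) (hbd (-T))).trans_eq ?_)
  have : -2 * Complex.I * ((-T : ℝ) : ℂ) = 2 * Complex.I * T := by push_cast; ring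
  rw [this, neg_neg]
  ring

/-! ### Lower bound for the oscillatory integral -/

theorem sq_le_one_sub_cos_two_mul {t : ℝ} (ht : |t| ≤ 1 / 2) :
    t ^ 2 ≤ 1 - Real.cos (2 * t) := by
  have h1 : |2 * t| ≤ 1 := by rw [abs_mul, abs_two]; linarith
  have h2 := (abs_le.1 (Real.cos_bound h1)).2
  rw [abs_mul, abs_two, show (2 * |t|) ^ 4 = 16 * (t ^ 2) ^ 2 by rw [← sq_abs t]; ring] at h2
  have h3 : t ^ 2 ≤ 1 / 4 := by rw [← sq_abs t]; nlinarith [abs_nonneg t]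
  nlinarith [sq_nonneg t]

theorem one_sub_cos_two_mul_le (t : ℝ) : 1 - Real.cos (2 * t) ≤ 2 * t ^ 2 := by
  have := Real.one_sub_sq_div_two_le_cos (x := 2 * t)
  nlinarith

theorem abs_two_mul_sub_sin_le {t : ℝ} (ht : |t| ≤ 1 / 2) :
    |2 * t - Real.sin (2 * t)| ≤ 2 * |t| ^ 3 := by
  have h1 : |2 * t| ≤ 1 := by rw [abs_mul, abs_two]; linarith
  have h2 := Real.sin_bound h1
  have h3 : 2 * t - Real.sin (2 * t) =
      -(Real.sin (2 * t) - (2 * t - (2 * t) ^ 3 / 6)) + (2 * t) ^ 3 / 6 := by ring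
  rw [h3]
  refine (abs_add_le _ _).trans ?_
  rw [abs_neg]
  have h4 : |(2 * t) ^ 3 / 6| = 8 * |t| ^ 3 / 6 := by
    rw [abs_div, abs_pow, abs_mul, abs_two, mul_pow]; norm_num
  rw [h4]
  rw [abs_mul, abs_two, show (2 * |t|) ^ 5 = 32 * (|t| ^ 3 * |t| ^ 2) by ring] at h2
  have h5 : |t| ^ 2 ≤ 1 := by nlinarith [abs_nonneg t]
  nlinarith [pow_nonneg (abs_nonneg t) 3, mul_le_mul_of_nonneg_left h5 (pow_nonneg (abs_nonneg t) 3)]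

/-- Decay rate of the evolved pairing. -/
noncomputable def decayExponent (a r t : ℝ) : ℝ :=
  a * (1 - Real.cos (2 * t)) + r * (2 * t - Real.sin (2 * t))

/-- Phase of the evolved pairing. -/
noncomputable def phaseAngle (a r t : ℝ) : ℝ :=
  a * (2 * t - Real.sin (2 * t)) - r * (1 - Real.cos (2 * t))

section StationaryPhase

variable {k a r t : ℝ}

theorem abs_mul_two_mul_sub_sin_le (hr : |r| ≤ k ^ 4) (ht : |t| ≤ 1 / 2) :
    |r * (2 * t - Real.sin (2 * t))| ≤ 2 * k ^ 4 * |t| ^ 3 := by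
  rw [abs_mul]
  refine (mul_le_mul hr (abs_two_mul_sub_sin_le ht) (abs_nonneg _) (by positivity)).trans_eq ?_
  ring

/-- The scale k = (Re z)^{1/8} makes |t| = k⁻³ an intermediate cutoff: beyond it the quadratic decay
a t² is already of size k², while below it the phase terms a t³ and r t² are still small. -/
theorem decayExponent_ge (hk : 4 ≤ k) (ha : 2 * a = k ^ 8 - 1) (hr : |r| ≤ k ^ 4)
    (ht : |t| ≤ 1 / 2) (ht' : 1 ≤ k ^ 3 * |t|) : k ^ 2 / 4 ≤ decayExponent a r t := by
  have h1 := (abs_le.1 (abs_mul_two_mul_sub_sin_le hr ht)).1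
  have hk4 : (256 : ℝ) ≤ k ^ 4 := by
    calc (256 : ℝ) = 4 ^ 4 := by norm_num
      _ ≤ k ^ 4 := pow_le_pow_left₀ (by norm_num) hk 4
  have hk8 : k ^ 8 = k ^ 4 * k ^ 4 := by ring
  have ha0 : 0 ≤ a := by nlinarith
  have h2 := mul_le_mul_of_nonneg_left (sq_le_one_sub_cos_two_mul ht) ha0
  have h3 : 2 * k ^ 4 * |t| ^ 3 ≤ k ^ 4 * t ^ 2 := by
    rw [← sq_abs t]
    have : |t| ^ 3 ≤ |t| ^ 2 * (1 / 2) := by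
      rw [pow_succ]; exact mul_le_mul_of_nonneg_left ht (by positivity)
    nlinarith
  have h4 : k ^ 8 / 4 ≤ a - k ^ 4 := by nlinarith
  have h5 := mul_le_mul_of_nonneg_right h4 (sq_nonneg t)
  have h6 : 1 ≤ k ^ 6 * t ^ 2 := by
    rw [← sq_abs t, show k ^ 6 * |t| ^ 2 = (k ^ 3 * |t|) ^ 2 by ring]
    exact one_le_pow₀ ht'
  have h7 : k ^ 2 ≤ k ^ 8 * t ^ 2 := by
    calc k ^ 2 ≤ k ^ 2 * (k ^ 6 * t ^ 2) := le_mul_of_one_le_right (by positivity) h6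
      _ = k ^ 8 * t ^ 2 := by ring
  unfold decayExponent
  linarith

theorem half_le_cos_phaseAngle (hk : 4 ≤ k) (ha : 2 * a = k ^ 8 - 1) (hr : |r| ≤ k ^ 4)
    (ht : |t| ≤ 1 / 2) (ht' : k ^ 3 * |t| ≤ 1) : 1 / 2 ≤ Real.cos (phaseAngle a r t) := by
  have hk0 : 0 < k := by linarith
  have hk8 : (1 : ℝ) ≤ k ^ 8 := one_le_pow₀ (by linarith)
  have ha0 : 0 ≤ a := by linarith
  have h1 : |a * (2 * t - Real.sin (2 * t))| ≤ k ^ 8 * |t| ^ 3 := by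
    rw [abs_mul, abs_of_nonneg ha0]
    refine (mul_le_mul_of_nonneg_left (abs_two_mul_sub_sin_le ht) ha0).trans ?_
    nlinarith [pow_nonneg (abs_nonneg t) 3]
  have h2 : |r * (1 - Real.cos (2 * t))| ≤ 2 * (k ^ 4 * |t| ^ 2) := by
    rw [abs_mul, abs_of_nonneg (by linarith [Real.cos_le_one (2 * t)] : 0 ≤ 1 - Real.cos (2 * t))]
    refine (mul_le_mul hr (one_sub_cos_two_mul_le t) (by linarith [Real.cos_le_one (2 * t)])
      (by positivity)).trans_eq ?_
    rw [sq_abs]; ring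
  have h3 : k ^ 8 * |t| ^ 3 ≤ 1 / 4 := by
    have : (k ^ 3 * |t|) ^ 3 ≤ 1 := pow_le_one₀ (by positivity) ht'
    have h9 : k * (k ^ 8 * |t| ^ 3) ≤ 1 := by
      calc k * (k ^ 8 * |t| ^ 3) = (k ^ 3 * |t|) ^ 3 := by ring
        _ ≤ 1 := this
    nlinarith [show 0 ≤ k ^ 8 * |t| ^ 3 by positivity]
  have h4 : k ^ 4 * |t| ^ 2 ≤ 1 / 4 := by
    have : (k ^ 3 * |t|) ^ 2 ≤ 1 := pow_le_one₀ (by positivity) ht'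
    have h9 : k ^ 2 * (k ^ 4 * |t| ^ 2) ≤ 1 := by
      calc k ^ 2 * (k ^ 4 * |t| ^ 2) = (k ^ 3 * |t|) ^ 2 := by ring
        _ ≤ 1 := this
    nlinarith [show 0 ≤ k ^ 4 * |t| ^ 2 by positivity]
  have h5 : |phaseAngle a r t| ≤ 1 := by
    refine (abs_sub _ _).trans ?_
    linarith
  have h6 := Real.one_sub_sq_div_two_le_cos (x := phaseAngle a r t)
  have h7 : phaseAngle a r t ^ 2 ≤ 1 := by
    rw [← sq_abs]; exact pow_le_one₀ (abs_nonneg _) h5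
  linarith

theorem neg_exp_le_stationaryPhase (hk : 4 ≤ k) (ha : 2 * a = k ^ 8 - 1) (hr : |r| ≤ k ^ 4)
    (ht : |t| ≤ 1 / 2) :
    -Real.exp (-(k ^ 2 / 4)) ≤
      Real.exp (-decayExponent a r t) * Real.cos (phaseAngle a r t) := by
  rcases le_total 1 (k ^ 3 * |t|) with h | h
  · have h1 := decayExponent_ge hk ha hr ht h
    have h2 : Real.exp (-decayExponent a r t) ≤ Real.exp (-(k ^ 2 / 4)) :=
      Real.exp_le_exp.2 (by linarith)
    nlinarith [Real.neg_one_le_cos (phaseAngle a r t), Real.exp_pos (-decayExponent a r t)]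
  · have h1 := half_le_cos_phaseAngle hk ha hr ht h
    have h2 : 0 ≤ Real.exp (-decayExponent a r t) * Real.cos (phaseAngle a r t) :=
      mul_nonneg (Real.exp_pos _).le (by linarith)
    linarith [Real.exp_pos (-(k ^ 2 / 4))]

theorem le_stationaryPhase (hk : 4 ≤ k) (ha : 2 * a = k ^ 8 - 1) (hr : |r| ≤ k ^ 4)
    (ht : k ^ 4 * |t| ≤ 1) :
    Real.exp (-2) / 2 ≤ Real.exp (-decayExponent a r t) * Real.cos (phaseAngle a r t) := by
  have hk0 : 0 < k := by linarith
  have hk4 : (256 : ℝ) ≤ k ^ 4 := by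
    calc (256 : ℝ) = 4 ^ 4 := by norm_num
      _ ≤ k ^ 4 := pow_le_pow_left₀ (by norm_num) hk 4
  have ht2 : |t| ≤ 1 / 2 := by nlinarith [abs_nonneg t]
  have ht3 : k ^ 3 * |t| ≤ 1 := by
    refine (mul_le_mul_of_nonneg_right ?_ (abs_nonneg t)).trans ht
    exact pow_le_pow_right₀ (by linarith) (by norm_num)
  have h1 := half_le_cos_phaseAngle hk ha hr ht2 ht3
  have hk8 : (1 : ℝ) ≤ k ^ 8 := one_le_pow₀ (by linarith)
  have ha0 : 0 ≤ a := by linarith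
  have h2 := mul_le_mul_of_nonneg_left (one_sub_cos_two_mul_le t) ha0
  have h3 := (abs_le.1 (abs_mul_two_mul_sub_sin_le hr ht2)).2
  have h4 : a * (2 * t ^ 2) ≤ 1 := by
    have h5 : (k ^ 4 * |t|) ^ 2 ≤ 1 := pow_le_one₀ (by positivity) ht
    have h6 : k ^ 8 * t ^ 2 ≤ 1 := by
      calc k ^ 8 * t ^ 2 = (k ^ 4 * |t|) ^ 2 := by rw [← sq_abs t]; ring
        _ ≤ 1 := h5
    nlinarith [sq_nonneg t]
  have h5 : 2 * k ^ 4 * |t| ^ 3 ≤ 1 := by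
    have : |t| ^ 2 ≤ 1 / 4 := by nlinarith [abs_nonneg t]
    nlinarith [mul_le_mul ht this (sq_nonneg |t|) zero_le_one]
  have h6 : decayExponent a r t ≤ 2 := by
    unfold decayExponent; linarith
  have h7 : Real.exp (-2) ≤ Real.exp (-decayExponent a r t) := Real.exp_le_exp.2 (by linarith)
  nlinarith [Real.exp_pos (-2)]

/-- The core |t| ≤ k⁻⁴ contributes at least k⁻⁴e⁻² ≥ k⁻⁴/9. Outside it the integrand is at least
-exp(-k²/4), over total length at most 1, which loses at most k⁻⁴/18. -/
theorem integral_stationaryPhase_ge (hk : 84 ≤ k) (ha : 2 * a = k ^ 8 - 1) (hr : |r| ≤ k ^ 4)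
    {T : ℝ} (hT : T ≤ 1 / 2) (hkT : 1 ≤ k ^ 4 * T) :
    1 / (18 * k ^ 4) ≤
      ∫ t in (-T)..T, Real.exp (-decayExponent a r t) * Real.cos (phaseAngle a r t) := by
  set J : ℝ → ℝ := fun t => Real.exp (-decayExponent a r t) * Real.cos (phaseAngle a r t) with hJ
  have hcont : Continuous J := by
    simp only [hJ, decayExponent, phaseAngle]; fun_prop
  have hk0 : 0 < k := by linarith
  have hk4 : 4 ≤ k := by linarith
  set d : ℝ := (k ^ 4)⁻¹ with hd
  have hd0 : 0 < d := by positivity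
  have hkd : k ^ 4 * d = 1 := mul_inv_cancel₀ (by positivity)
  have hdT : d ≤ T := by
    rw [hd, inv_le_iff_one_le_mul₀ (by positivity)]; linarith
  set e := Real.exp (-(k ^ 2 / 4)) with he
  have hside : ∀ x y : ℝ, x ≤ y → -(1 / 2) ≤ x → y ≤ 1 / 2 → (y - x) * (-e) ≤ ∫ t in x..y, J t := by
    intro x y hxy hx hy
    rw [← smul_eq_mul, ← intervalIntegral.integral_const]
    exact intervalIntegral.integral_mono_on hxy (by simp) (hcont.intervalIntegrable _ _)
      fun t ht => neg_exp_le_stationaryPhase hk4 ha hr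
        (abs_le.2 ⟨by linarith [ht.1], by linarith [ht.2]⟩)
  have hmid : (d - -d) * (Real.exp (-2) / 2) ≤ ∫ t in (-d)..d, J t := by
    rw [← smul_eq_mul, ← intervalIntegral.integral_const]
    refine intervalIntegral.integral_mono_on (by linarith) (by simp)
      (hcont.intervalIntegrable _ _) fun t ht => le_stationaryPhase hk4 ha hr ?_
    rw [← hkd]
    exact mul_le_mul_of_nonneg_left (abs_le.2 ⟨ht.1, ht.2⟩) (by positivity)
  have h1 := hside (-T) (-d) (by linarith) (by linarith) (by linarith)
  have h2 := hside d T hdT (by linarith) hT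
  rw [← intervalIntegral.integral_add_adjacent_intervals (a := -T) (b := -d) (c := T)
      (hcont.intervalIntegrable _ _) (hcont.intervalIntegrable _ _),
    ← intervalIntegral.integral_add_adjacent_intervals (a := -d) (b := d) (c := T)
      (hcont.intervalIntegrable _ _) (hcont.intervalIntegrable _ _)]
  have he0 : 0 < e := Real.exp_pos _
  have hed : e ≤ d / 18 := by
    have h3 := Real.pow_div_factorial_le_exp (k ^ 2 / 4) (by positivity) 3
    -- 6912 = 18 · 384 is what the cubic term of the exponential series requires; this is the origin
    -- of the threshold 84.
    have hk2 : (6912 : ℝ) ≤ k ^ 2 := by nlinarith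
    have h4 : 18 * k ^ 4 ≤ Real.exp (k ^ 2 / 4) := by
      refine le_trans ?_ h3
      have : (k ^ 2 / 4) ^ 3 / (Nat.factorial 3 : ℝ) = k ^ 4 * (k ^ 2 / 384) := by
        norm_num [Nat.factorial]; ring
      rw [this]
      nlinarith [show 0 < k ^ 4 by positivity]
    rw [he, Real.exp_neg, hd, div_eq_mul_inv (k ^ 4)⁻¹, ← mul_inv]
    exact inv_anti₀ (by positivity) (by linarith)
  have hexp2 : 1 / 9 ≤ Real.exp (-2) := by
    rw [Real.exp_neg, ← one_div]
    refine one_div_le_one_div_of_le (Real.exp_pos _) ?_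
    have h3 : Real.exp 2 = Real.exp 1 * Real.exp 1 := by rw [← Real.exp_add]; norm_num
    have h4 : Real.exp 1 ≤ 3 := Real.exp_one_lt_three.le
    rw [h3]; nlinarith [Real.exp_pos 1]
  have hgoal : 1 / (18 * k ^ 4) = d / 18 := by rw [hd]; field_simp
  rw [hgoal]
  nlinarith

end StationaryPhase

/-- The critical value e^{a+ir} factors out, and the modulus of the remaining integral is at least
its real part. -/
theorem norm_integral_evolution_ge {z : ℂ} {k T : ℝ} (hk : 84 ≤ k) (hz : z.re = k ^ 8)
    (hzi : |z.im| ≤ 2 * k ^ 4) (hT : T ≤ 1 / 2) (hkT : 1 ≤ k ^ 4 * T) :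
    Real.exp ((z.re - 1) / 2) / (18 * k ^ 4) ≤ ‖∫ t in (-T)..T,
      Complex.exp ((z - 1) * (Complex.I * t + Complex.exp (-2 * Complex.I * t) / 2))‖ := by
  set a := (z.re - 1) / 2 with ha
  set r := z.im / 2 with hr
  have hza : z - 1 = 2 * ((a : ℂ) + r * Complex.I) := by
    apply Complex.ext <;> simp [ha, hr] <;> ring
  have hkey : ∀ t : ℝ,
      Complex.exp ((z - 1) * (Complex.I * t + Complex.exp (-2 * Complex.I * t) / 2)) =
      Complex.exp ((a : ℂ) + r * Complex.I) *
        Complex.exp (((-decayExponent a r t : ℝ) : ℂ) + (phaseAngle a r t : ℝ) * Complex.I) := by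
    intro t
    rw [← Complex.exp_add]
    congr 1
    have : Complex.exp (-2 * Complex.I * t) =
        Complex.cos ((2 * t : ℝ) : ℂ) - Complex.sin ((2 * t : ℝ) : ℂ) * Complex.I := by
      rw [show (-2 * Complex.I * t : ℂ) = (-((2 * t : ℝ) : ℂ)) * Complex.I by push_cast; ring,
        Complex.exp_mul_I, Complex.cos_neg, Complex.sin_neg]
      ring
    rw [this, hza, decayExponent, phaseAngle]
    push_cast
    linear_combination (2 * (r : ℂ) * t - r * Complex.sin (2 * t)) * Complex.I_sq
  simp_rw [hkey]
  rw [intervalIntegral.integral_const_mul, norm_mul, Complex.norm_exp]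
  have hre : ((a : ℂ) + r * Complex.I).re = a := by simp
  rw [hre, div_eq_mul_one_div]
  refine mul_le_mul_of_nonneg_left ?_ (Real.exp_pos _).le
  refine (integral_stationaryPhase_ge (a := a) (r := r) hk (by rw [ha, hz]; ring)
    (by rw [hr, abs_div, abs_two]; linarith) hT hkT).trans ?_
  refine le_trans (le_of_eq ?_) ((le_abs_self _).trans (Complex.abs_re_le_norm _))
  have hint : IntervalIntegrable (fun t : ℝ => Complex.exp
      (((-decayExponent a r t : ℝ) : ℂ) + (phaseAngle a r t : ℝ) * Complex.I)) volume (-T) T := by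
    refine Continuous.intervalIntegrable ?_ _ _
    simp only [decayExponent, phaseAngle]
    fun_prop
  have h := Complex.reCLM.intervalIntegral_comp_comm hint
  simp only [Complex.reCLM_apply] at h
  rw [← h]
  refine intervalIntegral.integral_congr fun t _ => ?_
  simp [Complex.exp_re]

/-! ### Comparison of exponents and conclusion -/

/-- With T = ε/8 and s ≥ εl/2, the gain s(1 - cos 2T) ≥ sT² is at least ε³l/128, and the cubic loss
2|r|T³ is at most ε³l/256. -/
theorem coherent_exponent_le {ε l a r s ρ : ℝ} (hε : 0 < ε) (hε1 : ε ≤ 1) (hl : 0 ≤ l)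
    (hl2 : 2 ≤ ε * l ^ 2) (ha : 2 * a = l ^ 2 - 1) (hr : |r| ≤ (1 - ε) * l) (hρ : 0 ≤ ρ)
    (hρ2 : ρ ^ 2 = 4 * a ^ 2 + 4 * r ^ 2) (hs : 0 ≤ s) (hs2 : s ^ 2 = ρ - r ^ 2) :
    ρ / 2 - (2 * a * s + 2 * r ^ 2) / ρ + 1 + s * Real.cos (2 * (ε / 8)) +
      |r| * (2 * (ε / 8) ^ 3) ≤ a + 7 - ε ^ 3 / 256 * l := by
  have hN : 2 ≤ l ^ 2 := by nlinarith [sq_nonneg l]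
  have ha0 : 0 < a := by linarith
  have hr2 : r ^ 2 ≤ (1 - ε) ^ 2 * l ^ 2 := by
    rw [← sq_abs, ← mul_pow]; exact pow_le_pow_left₀ (abs_nonneg _) hr 2
  have hr3 : r ^ 2 ≤ l ^ 2 := hr2.trans (by nlinarith [sq_nonneg l])
  have hρa : 2 * a ≤ ρ := by
    refine le_of_sq_le_sq ?_ hρ
    nlinarith [sq_nonneg r]
  have hρ1 : 1 ≤ ρ := by linarith
  -- ρ² - 4a² = 4r² ≤ 4l² while 2a = l² - 1, so ρ - 2a is bounded. This costs 2 through ρ/2 and 4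
  -- through the quotient by ρ; with the explicit 1 the total is 7.
  have h4 : ρ - 2 * a ≤ 4 := by
    by_contra! h
    nlinarith
  have hsρ : s ≤ ρ := by
    refine le_of_sq_le_sq ?_ hρ
    nlinarith [sq_nonneg r]
  have hq : s - 4 ≤ (2 * a * s + 2 * r ^ 2) / ρ := by
    rw [le_div_iff₀ (by linarith)]
    nlinarith [mul_le_mul_of_nonneg_left h4 hs, sq_nonneg r]
  have hsl : ε / 2 * l ≤ s := by
    refine le_of_sq_le_sq ?_ hs
    have : (ε / 2 * l) ^ 2 ≤ ε * l ^ 2 / 2 := by nlinarith [mul_nonneg hε.le (sq_nonneg l)]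
    nlinarith [mul_nonneg (mul_nonneg hε.le (sub_nonneg.2 hε1)) (sq_nonneg l)]
  have hcos := sq_le_one_sub_cos_two_mul (t := ε / 8) (by rw [abs_of_pos (by positivity)]; linarith)
  have h5 := mul_le_mul_of_nonneg_left hcos hs
  have h6 := mul_le_mul_of_nonneg_right hsl (sq_nonneg (ε / 8))
  have h7 : |r| * (2 * (ε / 8) ^ 3) ≤ l * (2 * (ε / 8) ^ 3) :=
    mul_le_mul_of_nonneg_right (hr.trans (by nlinarith)) (by positivity)
  nlinarith

theorem IsResolventAt.exp_le_norm {z : ℂ} {R : L2R →L[ℂ] L2R} (hR : IsResolventAt shiftedHO z R)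
    {ε k : ℝ} (hε : 0 < ε) (hε1 : ε ≤ 1) (hk : 84 ≤ k) (hz : z.re = k ^ 8)
    (hkε : 8 ≤ ε * k ^ 4) (hzi : |z.im| ≤ 2 * (1 - ε) * k ^ 4) :
    Real.exp (ε ^ 3 / 256 * k ^ 4 - 7) / (36 * k ^ 4) ≤ ‖R‖ := by
  have hk4 : (1 : ℝ) ≤ k ^ 4 := one_le_pow₀ (by linarith)
  set a := (z.re - 1) / 2 with ha
  set r := z.im / 2 with hr
  have hza : z - 1 = 2 * ((a : ℂ) + r * Complex.I) := by
    apply Complex.ext <;> simp [ha, hr] <;> ring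
  set ρ := ‖z - 1‖ with hρ
  have hρ2 : ρ ^ 2 = 4 * a ^ 2 + 4 * r ^ 2 := by
    rw [hρ, Complex.sq_norm, Complex.normSq_apply, ha, hr]
    simp; ring
  have ha2 : 2 * a = (k ^ 4) ^ 2 - 1 := by rw [ha, hz]; ring
  have hra : |r| ≤ (1 - ε) * k ^ 4 := by rw [hr, abs_div, abs_two]; linarith
  have hr2 : r ^ 2 ≤ ρ := by
    have h1 : r ^ 2 ≤ (1 - ε) ^ 2 * (k ^ 4) ^ 2 := by
      rw [← sq_abs, ← mul_pow]; exact pow_le_pow_left₀ (abs_nonneg _) hra 2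
    have h2 : 2 * a ≤ ρ := le_of_sq_le_sq (by nlinarith [sq_nonneg r]) (norm_nonneg _)
    have h3 : (1 - ε) ^ 2 ≤ 1 - ε := by nlinarith
    nlinarith [mul_le_mul_of_nonneg_right h3 (sq_nonneg (k ^ 4))]
  have hρ0 : 0 < ρ := by
    have h2 : 2 * a ≤ ρ := le_of_sq_le_sq (by nlinarith [sq_nonneg r]) (norm_nonneg _)
    nlinarith
  set s := Real.sqrt (ρ - r ^ 2) with hs
  have hs0 : 0 ≤ s := Real.sqrt_nonneg _
  have hs2 : s ^ 2 = ρ - r ^ 2 := Real.sq_sqrt (by linarith)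
  -- Re u = r cancels the linear term in t of the boundary exponent -2rt + s cos 2t + r sin 2t. The
  -- choice |u|² = |v|² = ρ balances the norms, and Im u = -s makes t = 0 a maximum to second order.
  set u : ℂ := (r : ℂ) - s * Complex.I with hu
  set v : ℂ := (z - 1) * ((r : ℂ) + s * Complex.I) / ρ with hv
  have hsq : (r : ℂ) ^ 2 + (s : ℂ) ^ 2 = ρ := by
    rw [← Complex.ofReal_pow, ← Complex.ofReal_pow, ← Complex.ofReal_add, hs2]; congr 1; ring
  have hρc : (ρ : ℂ) ≠ 0 := Complex.ofReal_ne_zero.2 hρ0.ne'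
  have huv : u * v = z - 1 := by
    rw [hu, hv, mul_div_assoc', div_eq_iff hρc, ← hsq]
    linear_combination (-(z - 1) * (s : ℂ) ^ 2) * Complex.I_sq
  have hnu : ‖u‖ ^ 2 = ρ := by
    rw [Complex.sq_norm, Complex.normSq_apply, hu]; simp; nlinarith
  have hnv : ‖v‖ ^ 2 = ρ := by
    have h1 := congrArg (fun w : ℂ => ‖w‖ ^ 2) huv
    simp only [norm_mul, mul_pow] at h1
    rw [hnu, ← hρ] at h1
    exact mul_left_cancel₀ hρ0.ne' (h1.trans (sq ρ))
  have hvim : v.im = (2 * a * s + 2 * r ^ 2) / ρ := by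
    rw [hv, hza, Complex.div_ofReal_im]; congr 1; simp; ring
  set T := ε / 8 with hT
  have hT2 : |T| ≤ 1 / 2 := by rw [abs_of_pos (by positivity)]; linarith
  have him : ∀ θ : ℝ, (u * Complex.exp (θ * Complex.I)).im =
      r * Real.sin θ - s * Real.cos θ := fun θ => by
    rw [Complex.mul_im, Complex.exp_ofReal_mul_I_re, Complex.exp_ofReal_mul_I_im, hu]
    simp; ring
  have him1 : (u * Complex.exp (-2 * Complex.I * T)).im =
      -s * Real.cos (2 * T) - r * Real.sin (2 * T) := by
    rw [show (-2 * Complex.I * T : ℂ) = ((-(2 * T) : ℝ) : ℂ) * Complex.I by push_cast; ring,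
      him, Real.cos_neg, Real.sin_neg]
    ring
  have him2 : (u * Complex.exp (2 * Complex.I * T)).im =
      -s * Real.cos (2 * T) + r * Real.sin (2 * T) := by
    rw [show (2 * Complex.I * T : ℂ) = ((2 * T : ℝ) : ℂ) * Complex.I by push_cast; ring, him]
    ring
  have hmain := coherent_exponent_le hε hε1 (by positivity) (by nlinarith) ha2 hra
    (norm_nonneg _) hρ2 hs0 hs2
  rw [← hT] at hmain
  have hsin : |r * (2 * T - Real.sin (2 * T))| ≤ |r| * (2 * T ^ 3) := by
    rw [abs_mul]
    refine mul_le_mul_of_nonneg_left ((abs_two_mul_sub_sin_le hT2).trans_eq ?_) (abs_nonneg r)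
    rw [abs_of_pos (by positivity)]
  obtain ⟨hsin1, hsin2⟩ := abs_le.1 hsin
  have hrim : z.im = 2 * r := by rw [hr]; ring
  have hup := hR.norm_integral_le huv T
  have hlow := norm_integral_evolution_ge (T := T) hk hz
    (hzi.trans (by nlinarith)) (by linarith) (by rw [hT]; linarith)
  have hb : Real.exp ((‖u‖ ^ 2 + ‖v‖ ^ 2) / 4 - v.im + 1) *
        (Real.exp (-T * z.im - (u * Complex.exp (-2 * Complex.I * T)).im) +
         Real.exp (T * z.im - (u * Complex.exp (2 * Complex.I * T)).im)) ≤
      2 * (Real.exp a * Real.exp (-(ε ^ 3 / 256 * k ^ 4 - 7))) := by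
    rw [mul_add, ← Real.exp_add, ← Real.exp_add, ← Real.exp_add, two_mul (Real.exp _), hnu, hnv, hvim,
      him1, him2, hrim]
    refine add_le_add (Real.exp_le_exp.2 ?_) (Real.exp_le_exp.2 ?_) <;> linarith
  have h1 := (hlow.trans hup).trans (mul_le_mul_of_nonneg_left hb (norm_nonneg R))
  rw [Real.exp_neg] at h1
  rw [div_le_iff₀ (by positivity)] at h1 ⊢
  have he := Real.exp_pos (ε ^ 3 / 256 * k ^ 4 - 7)
  have h2 : Real.exp a * Real.exp (ε ^ 3 / 256 * k ^ 4 - 7) ≤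
      Real.exp a * (‖R‖ * (36 * k ^ 4)) := by
    refine (mul_le_mul_of_nonneg_right h1 he.le).trans_eq ?_
    field_simp
    ring
  exact le_of_mul_le_mul_left h2 (Real.exp_pos a)

theorem mainTheorem1 (ε : ℝ) (hε : 0 < ε) :
    ∃ C : ℝ, 0 < C ∧ ∀ z : ℂ, C < z.re → |z.im| ≤ 2 * (1 - ε) * Real.sqrt z.re →
      ENNReal.ofReal (C⁻¹ * Real.exp (Real.sqrt z.re / C)) ≤ resolventNorm shiftedHO z := by
  -- For ε > 1 the hypothesis on Im z cannot hold, so replacing ε by δ loses nothing.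
  set δ := min ε 1 with hδ
  have hδ0 : 0 < δ := lt_min hε one_pos
  have hδ1 : δ ≤ 1 := min_le_right _ _
  set c := δ ^ 3 / 256 with hc
  have hc0 : 0 < c := by positivity
  set A := 72 * Real.exp 7 / c with hA
  have hA0 : 0 < A := by positivity
  -- The summands ensure in turn k ≥ 84, T k⁴ ≥ 1 for T = δ/8, a small enough prefactor C⁻¹, and a
  -- rate 1/C ≤ c/2.
  refine ⟨84 ^ 8 + (8 / δ) ^ 2 + A + 2 / c, by positivity, fun z hz hzi => ?_⟩
  set C := 84 ^ 8 + (8 / δ) ^ 2 + A + 2 / c with hC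
  have hsq0 : 0 ≤ (8 / δ) ^ 2 := sq_nonneg _
  have h2c : 0 < 2 / c := by positivity
  have hC0 : 0 < C := by positivity
  -- On the spectrum the infimum is over an empty family, so that case is covered too.
  refine le_iInf₂ fun R hR => ?_
  rw [← ofReal_norm]
  refine ENNReal.ofReal_le_ofReal ?_
  have hN : 0 < z.re := hC0.trans hz
  set k := Real.sqrt (Real.sqrt (Real.sqrt z.re)) with hk
  have hk4 : k ^ 4 = Real.sqrt z.re := by
    rw [show k ^ 4 = (k ^ 2) ^ 2 by ring, hk, Real.sq_sqrt (Real.sqrt_nonneg _),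
      Real.sq_sqrt (Real.sqrt_nonneg _)]
  have hk8 : z.re = k ^ 8 := by
    rw [show k ^ 8 = (k ^ 4) ^ 2 by ring, hk4, Real.sq_sqrt hN.le]
  have hk84 : 84 ≤ k := by
    refine le_of_pow_le_pow_left₀ (n := 8) (by norm_num) (Real.sqrt_nonneg _) ?_
    rw [← hk8]; linarith
  have hkδ : 8 ≤ δ * k ^ 4 := by
    have : 8 / δ ≤ k ^ 4 := by
      rw [hk4]
      refine Real.le_sqrt_of_sq_le ?_
      have : (0 : ℝ) ≤ 84 ^ 8 := by norm_num
      linarith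
    rw [div_le_iff₀ hδ0] at this
    linarith
  have hzi' : |z.im| ≤ 2 * (1 - δ) * k ^ 4 := by
    rw [hk4]
    refine hzi.trans (mul_le_mul_of_nonneg_right ?_ (Real.sqrt_nonneg _))
    linarith [min_le_left ε 1]
  refine le_trans ?_ (hR.exp_le_norm hδ0 hδ1 hk84 hk8 hkδ hzi')
  rw [← hk4]
  have hl0 : 0 < k ^ 4 := by positivity
  set l := k ^ 4
  have h84 : (0 : ℝ) ≤ 84 ^ 8 := by norm_num
  have h1 : C⁻¹ ≤ A⁻¹ := inv_anti₀ hA0 (by linarith)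
  have h2 : l / C ≤ c * l / 2 := by
    rw [div_le_iff₀ hC0]
    have : 1 ≤ c / 2 * C := by
      have h3 : c / 2 * (2 / c) = 1 := by field_simp
      rw [← h3]
      exact mul_le_mul_of_nonneg_left (by linarith) (by positivity)
    nlinarith
  -- Half of the exponential e^{cl} is spent on absorbing the factor 36l in the denominator.
  have h3 : l * c / 2 ≤ Real.exp (c * l / 2) := by linarith [Real.add_one_le_exp (c * l / 2)]
  have h4 : Real.exp (c * l - 7) = Real.exp (c * l / 2) * Real.exp (c * l / 2) / Real.exp 7 := by
    rw [← Real.exp_add, ← Real.exp_sub]; congr 1; ring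
  refine (mul_le_mul h1 (Real.exp_le_exp.2 h2) (Real.exp_pos _).le (by positivity)).trans ?_
  rw [h4, le_div_iff₀ (by positivity), hA]
  have h5 : (72 * Real.exp 7 / c)⁻¹ * Real.exp (c * l / 2) * (36 * l) =
      (l * c / 2) * Real.exp (c * l / 2) / Real.exp 7 := by
    field_simp; ring
  rw [h5]
  exact div_le_div_of_nonneg_right (mul_le_mul_of_nonneg_right h3 (Real.exp_pos _).le)
    (Real.exp_pos _).le
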